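/- Let $n>-1$ be real and let $g(z)=\sum_{k\ge 0}\frac{\eta_k}{k!}z^k$ be a formal power series with complex coefficients and $\eta_0=1$. For $d\ge 1$ define the index-$n$ Laguerre–Jensen polynomial of $g$ by $$K_{d,g}(z)=\sum_{k=0}^d \eta_k\,(n+d)_k\binom{d}{k}z^k,\qquad (x)_k=x(x-1)\cdots(x-k+1).$$ Say that $g$ is in $\mathcal{LP}I$ if it converges on all of $\mathbb{C}$ and $$g(z)=e^{-\sigma^2 z}\prod_{j=1}^{N}\Bigl(1-\frac{z}{\alpha_j^2}\Bigr)\qquad(z\in\mathbb{C})$$ for some $\sigma\ge 0$, some $N\in\{0,1,2,\dots\}\cup\{\infty\}$ and nonzero real numbers $\alpha_j$ with $\sum_{j=1}^{N}\alpha_j^{-2}<\infty$. Then $g$ is in $\mathcal{LP}I$ if and only if, for every $d\ge 1$, all complex roots of $K_{d,g}$ (if any) are positive real numbers. Moreover, whenever $g$ converges on all of $\mathbb{C}$ (in particular, whenever $g$ is in $\mathcal{LP}I$), $$\lim_{d\to\infty}K_{d,g}\Bigl(\frac{z}{d(n+d)}\Bigr)=g(z)$$ uniformly on compact subsets of $\mathbb{C}$.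 -/

import Mathlib

open Filter Topology

noncomputable section

/-- The class `LP I` of entire functions
`f z = exp (-σ² z) * ∏_{j < N} (1 - z / α_j²)` with `σ ≥ 0`, real nonzero `α_j`,
`∑ 1 / α_j² < ∞`, and finitely or infinitely many factors (`N = ∞` is allowed). -/
def LaguerrePolyaI : Set (ℂ → ℂ) :=
  {f | ∃ (σ : ℝ) (N : ℕ∞) (α : {j : ℕ // (j : ℕ∞) < N} → ℝ),
    0 ≤ σ ∧ (∀ j, α j ≠ 0) ∧ Summable (fun j => 1 / α j ^ 2) ∧
    ∀ z : ℂ, f z = Complex.exp (-(σ : ℂ) ^ 2 * z) * ∏' j, (1 - z / (α j : ℂ) ^ 2)}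

/-- The formal power series `g` converges on all of `ℂ`, with sum `f`. -/
def HasEntireSum (g : PowerSeries ℂ) (f : ℂ → ℂ) : Prop :=
  ∀ z : ℂ, HasSum (fun k : ℕ => PowerSeries.coeff k g * z ^ k) (f z)

/-- The formal power series `g` is (the Taylor series at `0` of) a function in `LP I`. -/
def InLPI (g : PowerSeries ℂ) : Prop :=
  ∃ f ∈ LaguerrePolyaI, HasEntireSum g f

/-- The coefficients `η_k` in `g = ∑ η_k / k! z ^ k`. -/
def expCoeff (g : PowerSeries ℂ) (k : ℕ) : ℂ :=
  (k.factorial : ℂ) * PowerSeries.coeff k g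

/-- The index `n` Laguerre–Jensen polynomial
`K_{d,g}(z) = ∑_{k ≤ d} η_k (n + d)_k (d choose k) z ^ k`,
where `(x)_k = x (x - 1) ⋯ (x - k + 1)` is the falling factorial. -/
def laguerreJensen (n : ℝ) (g : PowerSeries ℂ) (d : ℕ) : Polynomial ℂ :=
  ∑ k ∈ Finset.range (d + 1),
    Polynomial.C (expCoeff g k * (((descPochhammer ℝ k).eval (n + d) : ℝ) : ℂ) *
      (d.choose k : ℂ)) * Polynomial.X ^ k

/-- Every complex root of `p` is a positive real number. -/
def OnlyPositiveRoots (p : Polynomial ℂ) : Prop :=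
  ∀ z : ℂ, p.IsRoot z → ∃ x : ℝ, 0 < x ∧ z = (x : ℂ)

end

/-! Let L p = (z p' + n p)', so that L z^m = m(m+n) z^(m-1). For a polynomial G, reversing G(L) z^d
gives K_{d,G}. The key point is that 1 - cL with c ≥ 0 preserves the class of polynomials with only
nonnegative roots (`NonnegRoots.sub_smul_laguerreOp`). Starting from z^d, every G = ∏(1 - c_i z)
with c_i ≥ 0 therefore has Jensen polynomials with positive roots. A function in LP I is a pointwise
limit of such products with ∑ c_i bounded, and positivity of the roots survives the limit
(`onlyPositiveRoots_of_tendsto`).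

Conversely, write K_d(z/(d(n+d))) = ∏(1 - β_i z). Its linear coefficient does not depend on d, so S
= ∑ β_i is fixed. This bounds the k-th coefficient of g by S^k/k!, so g is entire, and compactness
gives limits b_i of the ordered β_i. The factors (1 - β_i z)e^{β_i z} are dominated, whence
g(z)e^{Sz} = ∏(1 - b_i z)e^{b_i z}. The mass S - ∑ b_i lost in the limit becomes σ².

The uniform limit is dominated convergence: the scaled weights lie in [0,1] and tend to 1. -/

namespace LaguerreJensen
open Filter Topology Polynomial

/-! ### Logarithmic derivatives and nonnegative roots -/

/-- Every complex root of `p` is a nonnegative real number. -/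
def NonnegRoots (p : ℂ[X]) : Prop :=
  ∀ z : ℂ, p.IsRoot z → ∃ x : ℝ, 0 ≤ x ∧ z = (x : ℂ)

theorem NonnegRoots.eval_ne_zero_of_im {p : ℂ[X]} (h : NonnegRoots p) {z : ℂ} (hz : z.im ≠ 0) :
    p.eval z ≠ 0 := by
  intro h0
  obtain ⟨x, -, rfl⟩ := h z h0
  simp at hz

theorem NonnegRoots.eval_ne_zero_of_neg {p : ℂ[X]} (h : NonnegRoots p) {x : ℝ} (hx : x < 0) :
    p.eval (x : ℂ) ≠ 0 := by
  intro h0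
  obtain ⟨y, hy, h1⟩ := h _ h0
  rw [Complex.ofReal_inj] at h1
  linarith

/-- The factor `z.im` lets one sign condition serve both half planes. -/
theorem im_mul_im_inv_sub (z : ℂ) (r : ℝ) :
    z.im * (1 / (z - r)).im = -(z.im ^ 2 / Complex.normSq (z - r)) := by
  rw [one_div, Complex.inv_im]
  simp
  ring

theorem map_multiset_sum_nonpos {ι : Type*} (s : Multiset ι) (f : ι → ℂ) (φ : ℂ →+ ℝ)
    (h : ∀ i ∈ s, φ (f i) ≤ 0) : φ (s.map f).sum ≤ 0 := by
  induction s using Multiset.induction_on with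
  | empty => simp
  | cons a s ih =>
    rw [Multiset.map_cons, Multiset.sum_cons, map_add]
    exact add_nonpos (h a (Multiset.mem_cons_self a s))
      (ih fun i hi => h i (Multiset.mem_cons_of_mem hi))

theorem map_multiset_sum_neg {ι : Type*} (s : Multiset ι) (f : ι → ℂ) (φ : ℂ →+ ℝ)
    (h : ∀ i ∈ s, φ (f i) ≤ 0) {j : ι} (hj : j ∈ s) (hneg : φ (f j) < 0) :
    φ (s.map f).sum < 0 := by
  obtain ⟨t, rfl⟩ := Multiset.exists_cons_of_mem hj
  rw [Multiset.map_cons, Multiset.sum_cons, map_add]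
  have := map_multiset_sum_nonpos t f φ fun i hi => h i (Multiset.mem_cons_of_mem hi)
  linarith

/-- The additive functional `w ↦ y * im w`. -/
def imMul (y : ℝ) : ℂ →+ ℝ :=
  (AddMonoidHom.mulLeft y).comp Complex.imAddGroupHom

@[simp] theorem imMul_apply (y : ℝ) (w : ℂ) : imMul y w = y * w.im := rfl

theorem im_mul_im_logDeriv_neg {p : ℂ[X]} (h : ∀ w, p.IsRoot w → w.im = 0)
    (hdeg : 0 < p.natDegree) {z : ℂ} (hz : z.im ≠ 0) :
    z.im * (p.derivative.eval z / p.eval z).im < 0 := by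
  have hpz : p.eval z ≠ 0 := fun h0 => hz (h z h0)
  have key : ∀ r ∈ p.roots, imMul z.im (1 / (z - r)) < 0 := by
    intro r hr
    have hr' := h r (isRoot_of_mem_roots hr)
    have hr2 : r = (r.re : ℂ) := by apply Complex.ext <;> simp [hr']
    rw [hr2, imMul_apply, im_mul_im_inv_sub]
    have : z - r.re ≠ 0 := by
      intro h1
      apply hz
      simpa using congrArg Complex.im h1
    have := Complex.normSq_pos.2 this
    have := sq_pos_of_ne_zero hz
    rw [neg_lt_zero]
    positivity
  have hs := IsAlgClosed.splits p
  rw [hs.eval_derivative_div_eval_of_ne_zero hpz, ← imMul_apply]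
  rw [hs.natDegree_eq_card_roots] at hdeg
  obtain ⟨r, hr⟩ := Multiset.card_pos_iff_exists_mem.1 hdeg
  exact map_multiset_sum_neg _ _ _ (fun i hi => (key i hi).le) hr (key r hr)

/-- A product rather than a quotient, so that it chains: p'' = b p' and p' = a p. -/
theorem NonnegRoots.logDeriv_nonpos {p : ℂ[X]} (h : NonnegRoots p) {x : ℝ} (hx : x < 0) :
    ∃ a : ℝ, a ≤ 0 ∧ p.derivative.eval (x : ℂ) = a * p.eval (x : ℂ) := by
  have hpz := h.eval_ne_zero_of_neg hx
  have hs := IsAlgClosed.splits p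
  have key : ∀ r ∈ p.roots, (1 / ((x : ℂ) - r)).re ≤ 0 ∧ (1 / ((x : ℂ) - r)).im = 0 := by
    intro r hr
    obtain ⟨y, hy, rfl⟩ := h r (isRoot_of_mem_roots hr)
    rw [← Complex.ofReal_sub, ← Complex.ofReal_one, ← Complex.ofReal_div]
    refine ⟨?_, Complex.ofReal_im _⟩
    rw [Complex.ofReal_re]
    exact one_div_nonpos.2 (by linarith)
  refine ⟨(p.derivative.eval (x : ℂ) / p.eval (x : ℂ)).re, ?_, ?_⟩
  · rw [hs.eval_derivative_div_eval_of_ne_zero hpz]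
    exact map_multiset_sum_nonpos _ _ Complex.reAddGroupHom fun i hi => (key i hi).1
  · have him : (p.derivative.eval (x : ℂ) / p.eval (x : ℂ)).im = 0 := by
      rw [hs.eval_derivative_div_eval_of_ne_zero hpz, ← Complex.coe_imAddGroupHom,
        map_multiset_sum, Multiset.map_map]
      refine Multiset.sum_eq_zero ?_
      intro y hy
      obtain ⟨r, hr, rfl⟩ := Multiset.mem_map.1 hy
      exact (key r hr).2
    have : ((p.derivative.eval (x : ℂ) / p.eval (x : ℂ)).re : ℂ) =
        p.derivative.eval (x : ℂ) / p.eval (x : ℂ) := by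
      apply Complex.ext <;> simp [him]
    rw [this, div_mul_cancel₀ _ hpz]

/-- Gauss–Lucas, the nonnegative half-line being convex. -/
theorem NonnegRoots.derivative_of_natDegree_pos {p : ℂ[X]} (h : NonnegRoots p) (hdeg : 0 < p.natDegree) :
    NonnegRoots p.derivative := by
  intro z hz
  have hd : 0 < p.degree := natDegree_pos_iff_degree_pos.1 hdeg
  have hd0 : p.derivative ≠ 0 := by
    intro h0
    have := derivative_eq_zero.1 h0
    omega
  have h1 := rootSet_derivative_subset_convexHull_rootSet hd
    ((mem_rootSet_of_ne hd0).2 (by simpa using hz))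
  have hconv : Convex ℝ {z : ℂ | ∃ x : ℝ, 0 ≤ x ∧ z = (x : ℂ)} := by
    rintro _ ⟨x, hx, rfl⟩ _ ⟨y, hy, rfl⟩ a b ha hb hab
    exact ⟨a * x + b * y, by positivity, by simp⟩
  refine convexHull_min ?_ hconv h1
  intro w hw
  exact h w (by simpa using (mem_rootSet.1 hw).2)

/-! ### The Laguerre operator preserves nonnegative roots -/

/-- `z p' + n p`. -/
noncomputable def eulerOp (n : ℝ) : ℂ[X] →ₗ[ℂ] ℂ[X] :=
  LinearMap.mulLeft ℂ X ∘ₗ Polynomial.derivative + (n : ℂ) • LinearMap.id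

/-- The Laguerre derivative `p ↦ (z p' + n p)' = z p'' + (n + 1) p'`. -/
noncomputable def laguerreOp (n : ℝ) : Module.End ℂ ℂ[X] :=
  Polynomial.derivative ∘ₗ eulerOp n

theorem eulerOp_apply (n : ℝ) (p : ℂ[X]) :
    eulerOp n p = X * derivative p + C (n : ℂ) * p := by
  simp [eulerOp, smul_eq_C_mul]

theorem laguerreOp_apply (n : ℝ) (p : ℂ[X]) :
    laguerreOp n p = derivative (eulerOp n p) := rfl

theorem laguerreOp_eq (n : ℝ) (p : ℂ[X]) :
    laguerreOp n p = X * derivative (derivative p) + C ((n : ℂ) + 1) * derivative p := by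
  rw [laguerreOp_apply, eulerOp_apply]
  simp
  ring

theorem eulerOp_coeff (n : ℝ) (p : ℂ[X]) (k : ℕ) :
    (eulerOp n p).coeff k = (k + n) * p.coeff k := by
  rw [eulerOp_apply, coeff_add, coeff_C_mul]
  cases k with
  | zero => simp
  | succ k => rw [coeff_X_mul, coeff_derivative]; push_cast; ring

theorem natDegree_eulerOp_pos {n : ℝ} (hn : -1 < n) {p : ℂ[X]} (hdeg : 0 < p.natDegree) :
    0 < (eulerOp n p).natDegree := by
  refine hdeg.trans_le (le_natDegree_of_ne_zero ?_)
  rw [eulerOp_coeff]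
  refine mul_ne_zero ?_ (by
    rw [coeff_natDegree, leadingCoeff_ne_zero]
    rintro rfl
    simp at hdeg)
  have : (1 : ℝ) ≤ p.natDegree := by exact_mod_cast hdeg
  have h2 : (p.natDegree : ℝ) + n ≠ 0 := by linarith
  exact_mod_cast h2

/-- The quotient is n + ∑ z/(z - r), and z/(z - r) = 1 + r/(z - r) has imaginary part of sign
opposite to `z.im` when r > 0. The nonvanishing says that `eulerOp n p` has only real roots. -/
theorem NonnegRoots.im_mul_im_eulerOp {n : ℝ} (hn : -1 < n) {p : ℂ[X]} (h : NonnegRoots p)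
    (hdeg : 0 < p.natDegree) {z : ℂ} (hz : z.im ≠ 0) :
    z.im * ((eulerOp n p).eval z / p.eval z).im ≤ 0 ∧ (eulerOp n p).eval z ≠ 0 := by
  have hpz := h.eval_ne_zero_of_im hz
  have hs := IsAlgClosed.splits p
  have hz0 : ∀ r : ℝ, z - r ≠ 0 := fun r h1 => hz (by simpa using congrArg Complex.im h1)
  have hq : (eulerOp n p).eval z / p.eval z =
      (p.roots.map fun r => z / (z - r)).sum + n := by
    rw [eulerOp_apply, eval_add, eval_mul, eval_mul, eval_C, eval_X, add_div,
      mul_div_cancel_right₀ _ hpz, mul_div_assoc, hs.eval_derivative_div_eval_of_ne_zero hpz,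
      ← Multiset.sum_map_mul_left]
    simp [div_eq_mul_inv]
  have hterm : ∀ r : ℝ, imMul z.im (z / (z - r)) =
      -(r * (z.im ^ 2 / Complex.normSq (z - r))) := by
    intro r
    have : z / (z - r) = 1 + r * (1 / (z - r)) := by
      field_simp [hz0 r]
      ring
    rw [this, map_add, imMul_apply, imMul_apply, Complex.im_ofReal_mul, Complex.one_im, mul_zero,
      zero_add, mul_left_comm, im_mul_im_inv_sub, mul_neg]
  have hle : ∀ r ∈ p.roots, imMul z.im (z / (z - r)) ≤ 0 := by
    intro r hr
    obtain ⟨y, hy, rfl⟩ := h r (isRoot_of_mem_roots hr)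
    rw [hterm, neg_nonpos]
    exact mul_nonneg hy (div_nonneg (sq_nonneg _) (Complex.normSq_nonneg _))
  refine ⟨?_, ?_⟩
  · rw [hq]
    have := map_multiset_sum_nonpos _ _ (imMul z.im) hle
    simpa using this
  · intro h0
    rw [h0, zero_div] at hq
    -- If all roots are 0, the quotient is deg p + n, which is positive because n > -1.
    by_cases hall : ∀ r ∈ p.roots, r = 0
    · have h1 : (p.roots.map fun r => z / (z - r)) = p.roots.map fun _ => (1 : ℂ) := by
        refine Multiset.map_congr rfl fun r hr => ?_
        have := hz0 0
        rw [hall r hr]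
        rw [Complex.ofReal_zero, sub_zero] at this
        rw [sub_zero, div_self this]
      rw [h1] at hq
      simp at hq
      rw [← hs.natDegree_eq_card_roots] at hq
      have h3 : (p.natDegree : ℝ) + n = 0 := by exact_mod_cast hq.symm
      have : (1 : ℝ) ≤ p.natDegree := by exact_mod_cast hdeg
      linarith
    · push Not at hall
      obtain ⟨r, hr, hr0⟩ := hall
      have hneg : imMul z.im (z / (z - r)) < 0 := by
        obtain ⟨y, hy, rfl⟩ := h r (isRoot_of_mem_roots hr)
        have hy0 : 0 < y := lt_of_le_of_ne hy (by rintro rfl; simp at hr0)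
        rw [hterm, neg_lt_zero]
        have := Complex.normSq_pos.2 (hz0 y)
        have := sq_pos_of_ne_zero hz
        positivity
      have h2 := map_multiset_sum_neg _ _ (imMul z.im) hle hr hneg
      have h3 := congrArg (imMul z.im) hq
      rw [map_zero, map_add] at h3
      simp only [imMul_apply, Complex.ofReal_im, mul_zero, add_zero] at h2 h3
      linarith

/-- Put E = `eulerOp n`. A nonreal root gives (E p)'/(E p) = c⁻¹ (E p/p)⁻¹, whose two sides have
incompatible signs of the imaginary part. At a negative x, p' = a p and p'' = b p' with a, b ≤ 0
would force c(xb + n + 1)a = 1, although the left side is nonpositive. -/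
theorem NonnegRoots.sub_smul_laguerreOp {n : ℝ} (hn : -1 < n) {p : ℂ[X]} (h : NonnegRoots p)
    {c : ℝ} (hc : 0 ≤ c) : NonnegRoots (p - (c : ℂ) • laguerreOp n p) := by
  rcases hc.eq_or_lt with rfl | hc
  · simpa using h
  rcases Nat.eq_zero_or_pos p.natDegree with hdeg | hdeg
  · rw [eq_C_of_natDegree_eq_zero hdeg] at h ⊢
    simpa [laguerreOp_eq] using h
  intro z hz
  have hz' : p.eval z = c * (derivative (eulerOp n p)).eval z := by
    simpa [laguerreOp_apply, sub_eq_zero] using hz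
  have him : z.im = 0 := by
    by_contra him
    have hpz := h.eval_ne_zero_of_im him
    obtain ⟨h1, h2⟩ := h.im_mul_im_eulerOp hn hdeg him
    have h3 := im_mul_im_logDeriv_neg
      (fun w hw => by_contra fun hw' => (h.im_mul_im_eulerOp hn hdeg hw').2 hw)
      (natDegree_eulerOp_pos hn hdeg) him
    have h4 : (derivative (eulerOp n p)).eval z / (eulerOp n p).eval z =
        ((c⁻¹ : ℝ) : ℂ) * ((eulerOp n p).eval z / p.eval z)⁻¹ := by
      have : (c : ℂ) ≠ 0 := by exact_mod_cast hc.ne'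
      rw [inv_div, hz']
      push_cast
      field_simp
    rw [h4, Complex.im_ofReal_mul, Complex.inv_im] at h3
    have h5 := Complex.normSq_pos.2 (div_ne_zero h2 hpz)
    have h6 : 0 ≤ c⁻¹ * (-(z.im * ((eulerOp n p).eval z / p.eval z).im) /
      Complex.normSq ((eulerOp n p).eval z / p.eval z)) :=
      mul_nonneg (inv_nonneg.2 hc.le) (div_nonneg (by linarith) h5.le)
    have h7 : z.im * (c⁻¹ * (-((eulerOp n p).eval z / p.eval z).im /
      Complex.normSq ((eulerOp n p).eval z / p.eval z))) =
        c⁻¹ * (-(z.im * ((eulerOp n p).eval z / p.eval z).im) /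
      Complex.normSq ((eulerOp n p).eval z / p.eval z)) := by ring
    linarith
  obtain ⟨x, rfl⟩ : ∃ x : ℝ, z = x := ⟨z.re, by apply Complex.ext <;> simp [him]⟩
  refine ⟨x, ?_, rfl⟩
  by_contra! hx
  have hpx := h.eval_ne_zero_of_neg hx
  obtain ⟨a, ha, ha'⟩ := h.logDeriv_nonpos hx
  obtain ⟨b, hb, hb'⟩ := (h.derivative_of_natDegree_pos hdeg).logDeriv_nonpos hx
  rw [← laguerreOp_apply, laguerreOp_eq] at hz'
  simp only [eval_add, eval_mul, eval_X, eval_C, hb', ha'] at hz'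
  have h8 : ((c * ((x * b + (n + 1)) * a) : ℝ) : ℂ) = 1 := by
    refine mul_right_cancel₀ hpx ?_
    rw [one_mul]
    push_cast
    linear_combination -hz'
  have h9 : c * ((x * b + (n + 1)) * a) = 1 := by exact_mod_cast h8
  have h10 : 0 ≤ x * b := mul_nonneg_of_nonpos_of_nonpos hx.le hb
  have h11 : (x * b + (n + 1)) * a ≤ 0 := mul_nonpos_of_nonneg_of_nonpos (by linarith) ha
  have := mul_nonpos_of_nonneg_of_nonpos hc.le h11
  linarith

/-! ### Jensen polynomials from powers of the Laguerre operator -/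

/-- The factor `(n + d)_k (d)_k` of the `k`-th coefficient. -/
noncomputable def weight (n : ℝ) (d k : ℕ) : ℝ :=
  (descPochhammer ℝ k).eval (n + d) * d.descFactorial k

theorem weight_zero (n : ℝ) (d : ℕ) : weight n d 0 = 1 := by simp [weight]

theorem weight_of_lt (n : ℝ) {d k : ℕ} (h : d < k) : weight n d k = 0 := by
  simp [weight, Nat.descFactorial_eq_zero_iff_lt.2 h]

theorem weight_succ (n : ℝ) {d k : ℕ} (h : k ≤ d) :
    weight n d (k + 1) = weight n d k * ((n + d - k) * (d - k)) := by
  rw [weight, weight, descPochhammer_succ_eval, Nat.descFactorial_succ]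
  push_cast [h]
  ring

/-- The polynomial `∑_{k ≤ d} c_k (n + d)_k (d)_k z ^ k`. -/
noncomputable def jensen (n : ℝ) (c : ℕ → ℂ) (d : ℕ) : ℂ[X] :=
  ∑ k ∈ Finset.range (d + 1), C (c k * (weight n d k : ℂ)) * X ^ k

theorem laguerreJensen_eq_jensen (n : ℝ) (g : PowerSeries ℂ) (d : ℕ) :
    laguerreJensen n g d = jensen n (fun k => PowerSeries.coeff k g) d := by
  refine Finset.sum_congr rfl fun k _ => ?_
  rw [weight, expCoeff, Nat.descFactorial_eq_factorial_mul_choose]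
  push_cast
  congr 2
  ring

theorem jensen_coeff (n : ℝ) (c : ℕ → ℂ) (d k : ℕ) :
    (jensen n c d).coeff k = c k * (weight n d k : ℂ) := by
  simp only [jensen, finsetSum_coeff, coeff_C_mul, coeff_X_pow, mul_ite, mul_one, mul_zero]
  rw [Finset.sum_ite_eq]
  split_ifs with h
  · rfl
  · rw [weight_of_lt n (by simpa using h)]
    simp

theorem natDegree_jensen_le (n : ℝ) (c : ℕ → ℂ) (d : ℕ) : (jensen n c d).natDegree ≤ d := by
  refine natDegree_le_iff_coeff_eq_zero.2 fun k hk => ?_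
  rw [jensen_coeff, weight_of_lt n hk]
  simp

theorem laguerreOp_X_pow (n : ℝ) (m : ℕ) :
    laguerreOp n (X ^ m) = C ((m : ℂ) * (m + n)) * X ^ (m - 1) := by
  have : eulerOp n (X ^ m) = C ((m : ℂ) + n) * X ^ m := by
    ext k
    rw [eulerOp_coeff, coeff_C_mul, coeff_X_pow]
    split_ifs with h
    · rw [h]
    · simp
  rw [laguerreOp_apply, this, derivative_C_mul, derivative_X_pow, ← mul_assoc, ← C_mul]
  ring_nf

theorem laguerreOp_pow_X_pow (n : ℝ) (d k : ℕ) :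
    (laguerreOp n ^ k) (X ^ d) = C (weight n d k : ℂ) * X ^ (d - k) := by
  induction k with
  | zero => simp [weight_zero]
  | succ k ih =>
    rw [pow_succ', Module.End.mul_apply, ih, ← smul_eq_C_mul, map_smul, laguerreOp_X_pow,
      smul_eq_C_mul, ← mul_assoc, ← C_mul, Nat.sub_sub]
    rcases le_or_gt k d with h | h
    · rw [weight_succ n h]
      push_cast [h]
      congr 2
      ring
    · rw [weight_of_lt n h, weight_of_lt n (h.trans (Nat.lt_succ_self k))]
      simp

theorem eval_aeval_laguerreOp (n : ℝ) (G : ℂ[X]) (d : ℕ) {z : ℂ} (hz : z ≠ 0) :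
    z ^ d * (aeval (laguerreOp n) G (X ^ d)).eval z⁻¹ = (jensen n G.coeff d).eval z := by
  have hN : G.natDegree < G.natDegree + d + 1 := by omega
  rw [aeval_eq_sum_range' hN, LinearMap.sum_apply, eval_finsetSum, Finset.mul_sum, jensen,
    eval_finsetSum]
  symm
  refine Finset.sum_subset_zero_on_sdiff (by
    intro k hk
    rw [Finset.mem_range] at hk ⊢
    omega) ?_ ?_
  · intro k hk
    have hk' : d < k := by simpa using (Finset.mem_sdiff.1 hk).2
    rw [LinearMap.smul_apply, laguerreOp_pow_X_pow, weight_of_lt n hk']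
    simp
  · intro k hk
    have hk' : k ≤ d := by simpa [Nat.lt_succ_iff] using hk
    rw [LinearMap.smul_apply, laguerreOp_pow_X_pow]
    simp only [eval_mul, eval_C, eval_pow, eval_X, eval_smul, smul_eq_mul]
    rw [inv_pow, ← pow_sub_mul_pow z hk']
    field_simp

/-- The polynomial `∏_{c ∈ s} (1 - c z)`. -/
noncomputable def prodPoly (s : Multiset ℝ) : ℂ[X] :=
  (s.map fun c : ℝ => 1 - C (c : ℂ) * X).prod

theorem prodPoly_cons (c : ℝ) (s : Multiset ℝ) :
    prodPoly (c ::ₘ s) = (1 - C (c : ℂ) * X) * prodPoly s := by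
  simp [prodPoly]

theorem prodPoly_coeff_zero (s : Multiset ℝ) : (prodPoly s).coeff 0 = 1 := by
  induction s using Multiset.induction_on with
  | empty => simp [prodPoly]
  | cons c s ih => rw [prodPoly_cons, mul_coeff_zero, ih]; simp

/-- One operator 1 - cL per factor, starting from `X ^ d`. That start has root 0, hence nonnegative
rather than positive roots; the reversal removes the root 0. -/
theorem nonnegRoots_aeval_prodPoly {n : ℝ} (hn : -1 < n) {s : Multiset ℝ}
    (hs : ∀ c ∈ s, 0 ≤ c) (d : ℕ) :
    NonnegRoots (aeval (laguerreOp n) (prodPoly s) (X ^ d)) := by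
  induction s using Multiset.induction_on with
  | empty =>
    intro z hz
    refine ⟨0, le_rfl, ?_⟩
    simp [prodPoly] at hz
    simp [hz.1]
  | cons c s ih =>
    have := (ih fun c hc => hs c (Multiset.mem_cons_of_mem hc)).sub_smul_laguerreOp hn
      (hs c (Multiset.mem_cons_self c s))
    rw [prodPoly_cons, map_mul, Module.End.mul_apply]
    convert! this using 1
    simp [Module.algebraMap_end_apply]

theorem onlyPositiveRoots_jensen_prodPoly {n : ℝ} (hn : -1 < n) {s : Multiset ℝ}
    (hs : ∀ c ∈ s, 0 ≤ c) (d : ℕ) : OnlyPositiveRoots (jensen n (prodPoly s).coeff d) := by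
  intro z hz
  have hz0 : z ≠ 0 := by
    rintro rfl
    rw [IsRoot.def, ← coeff_zero_eq_eval_zero, jensen_coeff, prodPoly_coeff_zero,
      weight_zero] at hz
    simp at hz
  rw [IsRoot.def, ← eval_aeval_laguerreOp n _ d hz0] at hz
  obtain ⟨x, hx, h⟩ := nonnegRoots_aeval_prodPoly hn hs d z⁻¹
    ((mul_eq_zero.1 hz).resolve_left (pow_ne_zero _ hz0))
  refine ⟨x⁻¹, inv_pos.2 (lt_of_le_of_ne hx ?_), ?_⟩
  · rintro rfl
    simp [hz0] at h
  · rw [Complex.ofReal_inv, ← h, inv_inv]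

/-! ### Factorization and stability of positive roots under limits -/

/-- Polynomials with constant coefficient `1` and positive roots `r` are products of
`1 - z / r`; the numbers `1 / r` are listed in decreasing order. -/
theorem exists_antitone_factorization {p : ℂ[X]} (h0 : p.coeff 0 = 1)
    (hp : OnlyPositiveRoots p) :
    ∃ (m : ℕ) (β : ℕ → ℝ), m ≤ p.natDegree ∧ Antitone β ∧ (∀ i, 0 ≤ β i) ∧
      (∀ i, m ≤ i → β i = 0) ∧ p = prodPoly ((Multiset.range m).map β) := by
  have hsp := IsAlgClosed.splits p
  have hr0 : ∀ r ∈ p.roots, r ≠ 0 := by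
    rintro r hr rfl
    have := isRoot_of_mem_roots hr
    rw [IsRoot.def, ← coeff_zero_eq_eval_zero, h0] at this
    exact one_ne_zero this
  have hprod : p = (p.roots.map fun r => 1 - C r⁻¹ * X).prod := by
    have h1 : p.roots.map (fun r => X - C r) =
        p.roots.map (fun r => C (-r) * (1 - C r⁻¹ * X)) := by
      refine Multiset.map_congr rfl fun r hr => ?_
      rw [mul_sub, ← mul_assoc, ← C_mul, neg_mul, mul_inv_cancel₀ (hr0 r hr)]
      simp
      ring
    have h2 := hsp.eq_prod_roots
    have h5 : (p.roots.map fun r => C (-r)).prod = C (p.roots.map fun r => -r).prod := by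
      rw [map_multiset_prod, Multiset.map_map]
      rfl
    rw [h1, Multiset.prod_map_mul, h5, ← mul_assoc, ← C_mul] at h2
    have h3 : (p.roots.map fun r => 1 - C r⁻¹ * X).prod.coeff 0 = 1 := by
      rw [coeff_zero_eq_eval_zero, eval_multiset_prod, Multiset.map_map]
      refine Multiset.prod_eq_one fun y hy => ?_
      obtain ⟨r, -, rfl⟩ := Multiset.mem_map.1 hy
      simp
    -- Comparing constant coefficients shows that the collected scalar is 1.
    have h4 := congrArg (fun q : ℂ[X] => q.coeff 0) h2
    simp only [coeff_C_mul, h3, mul_one, h0] at h4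
    rw [← h4, C_1, one_mul] at h2
    exact h2
  set s : Multiset ℝ := p.roots.map fun r => (r⁻¹).re with hs
  have hps : p = prodPoly s := by
    conv_lhs => rw [hprod]
    rw [prodPoly, hs, Multiset.map_map]
    refine congrArg _ (Multiset.map_congr rfl fun r hr => ?_)
    obtain ⟨x, hx, rfl⟩ := hp r (isRoot_of_mem_roots hr)
    simp [← Complex.ofReal_inv]
  have hspos : ∀ c ∈ s, 0 ≤ c := by
    intro c hc
    obtain ⟨r, hr, rfl⟩ := Multiset.mem_map.1 hc
    obtain ⟨x, hx, rfl⟩ := hp r (isRoot_of_mem_roots hr)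
    rw [← Complex.ofReal_inv, Complex.ofReal_re]
    positivity
  -- The default 0 in `getD` extends the decreasing list to an antitone sequence.
  set l := s.sort (· ≥ ·) with hl
  have hls : (l : Multiset ℝ) = s := Multiset.sort_eq _ _
  have hlpos : ∀ c ∈ l, 0 ≤ c := fun c hc => hspos c (by simpa [hl] using hc)
  have hlen : l.length = p.natDegree := by
    rw [hsp.natDegree_eq_card_roots, hl, Multiset.length_sort, hs, Multiset.card_map]
  have hnn : ∀ i, 0 ≤ l.getD i 0 := by
    intro i
    rcases lt_or_ge i l.length with hi | hi
    · rw [List.getD_eq_getElem _ _ hi]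
      exact hlpos _ (List.getElem_mem hi)
    · rw [List.getD_eq_default _ _ hi]
  refine ⟨l.length, fun i => l.getD i 0, hlen.le, ?_, hnn,
    fun i hi => List.getD_eq_default _ _ hi, ?_⟩
  · intro i j hij
    show l.getD j 0 ≤ l.getD i 0
    rcases lt_or_ge j l.length with hj | hj
    · rw [List.getD_eq_getElem _ _ hj, List.getD_eq_getElem _ _ (hij.trans_lt hj)]
      rcases hij.eq_or_lt with rfl | hij
      · rfl
      · exact List.pairwise_iff_getElem.1 (Multiset.pairwise_sort s (· ≥ ·)) i j _ hj hij
    · rw [List.getD_eq_default _ _ hj]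
      exact hnn i
  · have : (Multiset.range l.length).map (fun i => l.getD i 0) = s := by
      rw [← hls, ← Multiset.coe_range, Multiset.map_coe]
      congr 1
      refine List.ext_getElem (by simp) fun i h1 h2 => ?_
      rw [List.getElem_map, List.getElem_range, List.getD_eq_getElem _ _ h2]
    rw [this]
    exact hps

/-- For nonreal z, |Im z|/|z| is the distance from 1 to the real line spanned by z. -/
theorem exists_lower_bound {z : ℂ} (hz : ¬ ∃ x : ℝ, 0 < x ∧ z = (x : ℂ)) :
    ∃ κ : ℝ, 0 < κ ∧ κ ≤ 1 ∧ ∀ t : ℝ, 0 ≤ t → κ ≤ ‖1 - t * z‖ := by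
  by_cases him : z.im = 0
  · refine ⟨1, one_pos, le_rfl, fun t ht => ?_⟩
    have hre : z.re ≤ 0 := by
      by_contra! h
      exact hz ⟨z.re, h, by apply Complex.ext <;> simp [him]⟩
    refine le_trans ?_ (Complex.re_le_norm _)
    simp
    exact mul_nonpos_of_nonneg_of_nonpos ht hre
  · have hz0 : 0 < ‖z‖ := norm_pos_iff.2 (by rintro rfl; simp at him)
    refine ⟨|z.im| / ‖z‖, div_pos (abs_pos.2 him) hz0,
      (div_le_one hz0).2 (Complex.abs_im_le_norm z), fun t _ => ?_⟩
    rw [div_le_iff₀ hz0]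
    refine abs_le_of_sq_le_sq (a := z.im) ?_ (by positivity)
    · rw [mul_pow, ← Complex.normSq_eq_norm_sq, ← Complex.normSq_eq_norm_sq,
        Complex.normSq_apply, Complex.normSq_apply]
      simp
      nlinarith [sq_nonneg (z.re - t * (z.re ^ 2 + z.im ^ 2))]

/-- A quantitative substitute for Hurwitz's theorem: the bound sees only d, not p. `κ ≤ 1` allows
for fewer than d factors. -/
theorem norm_eval_ge {p : ℂ[X]} (h0 : p.coeff 0 = 1) (hp : OnlyPositiveRoots p) {d : ℕ}
    (hd : p.natDegree ≤ d) {z : ℂ} {κ : ℝ} (hκ : 0 < κ) (hκ1 : κ ≤ 1)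
    (h : ∀ t : ℝ, 0 ≤ t → κ ≤ ‖1 - t * z‖) : κ ^ d ≤ ‖p.eval z‖ := by
  obtain ⟨m, β, hm, -, hβ, -, hpβ⟩ := exists_antitone_factorization h0 hp
  have h1 : p.eval z = ∏ i ∈ Finset.range m, (1 - β i * z) := by
    rw [hpβ, prodPoly, Multiset.map_map, eval_multiset_prod, Multiset.map_map, Finset.prod]
    simp [Function.comp_def]
  rw [h1, norm_prod]
  calc κ ^ d ≤ κ ^ m := pow_le_pow_of_le_one hκ.le hκ1 (hm.trans hd)
    _ = ∏ i ∈ Finset.range m, κ := by simp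
    _ ≤ _ := Finset.prod_le_prod (fun _ _ => hκ.le) fun i _ => h _ (hβ i)

/-- Positivity of all roots is preserved under coefficientwise limits in bounded degree. -/
theorem onlyPositiveRoots_of_tendsto {ι : Type*} {F : Filter ι} [F.NeBot] {P : ι → ℂ[X]}
    {p : ℂ[X]} {d : ℕ} (hP0 : ∀ i, (P i).coeff 0 = 1) (hPd : ∀ i, (P i).natDegree ≤ d)
    (hP : ∀ i, OnlyPositiveRoots (P i)) (hpd : p.natDegree ≤ d)
    (hlim : ∀ k, Tendsto (fun i => (P i).coeff k) F (𝓝 (p.coeff k))) : OnlyPositiveRoots p := by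
  intro z hz
  by_contra hcon
  obtain ⟨κ, hκ, hκ1, h⟩ := exists_lower_bound hcon
  have ht : Tendsto (fun i => (P i).eval z) F (𝓝 (p.eval z)) := by
    simp_rw [eval_eq_sum_range' (Nat.lt_succ_of_le (hPd _)),
      eval_eq_sum_range' (Nat.lt_succ_of_le hpd)]
    exact tendsto_finsetSum _ fun k _ => (hlim k).mul_const _
  have := ge_of_tendsto' ht.norm fun i => norm_eval_ge (hP0 i) (hP i) (hPd i) hκ hκ1 h
  rw [show p.eval z = 0 from hz, norm_zero] at this
  exact absurd this (not_le.2 (pow_pos hκ d))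

/-! ### Scaled weights and locally uniform convergence -/

theorem weight_mem {n : ℝ} (hn : -1 < n) (d k : ℕ) :
    0 ≤ weight n d k ∧ weight n d k ≤ (d * (n + d)) ^ k := by
  rcases Nat.eq_zero_or_pos d with rfl | hd
  · cases k with
    | zero => simp [weight_zero]
    | succ k => rw [weight_of_lt n (Nat.succ_pos k)]; simp
  have hd1 : (1 : ℝ) ≤ d := by exact_mod_cast hd
  induction k with
  | zero => simp [weight_zero]
  | succ k ih =>
    have hpos : 0 ≤ (d : ℝ) * (n + d) := mul_nonneg (by linarith) (by linarith)
    rcases le_or_gt k d with h | h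
    · rw [weight_succ n h, pow_succ]
      have h1 : 0 ≤ (n + d - k) * ((d : ℝ) - k) ∧
          (n + d - k) * ((d : ℝ) - k) ≤ d * (n + d) := by
        -- At k = d the factor n + d - k = n may be negative, but d - k vanishes.
        rcases h.eq_or_lt with rfl | h
        · simpa using hpos
        · have h2 : (k : ℝ) + 1 ≤ d := by exact_mod_cast h
          have h3 : (0 : ℝ) ≤ k := k.cast_nonneg
          refine ⟨mul_nonneg (by linarith) (by linarith), ?_⟩
          rw [mul_comm]
          exact mul_le_mul (by linarith) (by linarith) (by linarith) (by linarith)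
      exact ⟨mul_nonneg ih.1 h1.1, mul_le_mul ih.2 h1.2 h1.1 (pow_nonneg hpos k)⟩
    · rw [weight_of_lt n (h.trans (Nat.lt_succ_self k))]
      exact ⟨le_rfl, pow_nonneg hpos _⟩

/-- The `k`-th weight normalized by the scaling `z ↦ z / (d (n + d))`. -/
noncomputable def ratio (n : ℝ) (d k : ℕ) : ℝ := weight n d k / (d * (n + d)) ^ k

theorem ratio_nonneg {n : ℝ} (hn : -1 < n) (d k : ℕ) : 0 ≤ ratio n d k := by
  rcases Nat.eq_zero_or_pos d with rfl | hd
  · cases k <;> simp [ratio, weight_zero]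
  have hd1 : (1 : ℝ) ≤ d := by exact_mod_cast hd
  exact div_nonneg (weight_mem hn d k).1
    (pow_nonneg (mul_nonneg (by linarith) (by linarith)) k)

theorem ratio_le_one {n : ℝ} (hn : -1 < n) (d k : ℕ) : ratio n d k ≤ 1 := by
  have h := weight_mem hn d k
  exact div_le_one_of_le₀ h.2 (h.1.trans h.2)

theorem tendsto_ratio (n : ℝ) (k : ℕ) : Tendsto (fun d => ratio n d k) atTop (𝓝 1) := by
  induction k with
  | zero => simp [ratio, weight_zero]
  | succ k ih =>
    have hd : Tendsto (fun d : ℕ => (d : ℝ)) atTop atTop := tendsto_natCast_atTop_atTop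
    have hnd : Tendsto (fun d : ℕ => n + (d : ℝ)) atTop atTop :=
      tendsto_atTop_add_const_left _ _ hd
    have h1 : Tendsto (fun d : ℕ => 1 - (k : ℝ) / d) atTop (𝓝 (1 - 0)) :=
      tendsto_const_nhds.sub (tendsto_const_nhds.div_atTop hd)
    have h2 : Tendsto (fun d : ℕ => 1 - (k : ℝ) / (n + d)) atTop (𝓝 (1 - 0)) :=
      tendsto_const_nhds.sub (tendsto_const_nhds.div_atTop hnd)
    have h3 := (ih.mul h1).mul h2
    simp only [sub_zero, mul_one] at h3
    refine h3.congr' ?_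
    filter_upwards [eventually_ge_atTop k, hd.eventually_gt_atTop 0,
      hnd.eventually_gt_atTop 0] with d hk h4 h5
    rw [ratio, ratio, weight_succ n hk, pow_succ]
    have := h4.ne'
    have := h5.ne'
    field_simp

theorem hasSum_eval_jensen (n : ℝ) (c : ℕ → ℂ) (d : ℕ) (z : ℂ) :
    HasSum (fun k => c k * z ^ k * (ratio n d k : ℂ))
      ((jensen n c d).eval (z / ((d : ℂ) * ((n : ℂ) + (d : ℂ))))) := by
  have : (jensen n c d).eval (z / ((d : ℂ) * ((n : ℂ) + (d : ℂ)))) =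
      ∑ k ∈ Finset.range (d + 1), c k * z ^ k * (ratio n d k : ℂ) := by
    rw [jensen, eval_finsetSum]
    refine Finset.sum_congr rfl fun k _ => ?_
    simp only [eval_mul, eval_C, eval_pow, eval_X, ratio, div_pow]
    push_cast
    ring
  rw [this]
  refine hasSum_sum_of_ne_finset_zero fun k hk => ?_
  rw [ratio, weight_of_lt n (by simpa using hk)]
  simp

/-- For |z| ≤ R the error is at most ∑ |c_k| R^k (1 - `ratio n d k`), which no longer involves z and
tends to 0 by dominated convergence. -/
theorem tendstoUniformlyOn_jensen {n : ℝ} (hn : -1 < n) {c : ℕ → ℂ} {f : ℂ → ℂ}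
    (hf : ∀ z, HasSum (fun k => c k * z ^ k) (f z)) {S : Set ℂ} (hS : IsCompact S) :
    TendstoUniformlyOn
      (fun (d : ℕ) (z : ℂ) => (jensen n c d).eval (z / ((d : ℂ) * ((n : ℂ) + (d : ℂ)))))
      f atTop S := by
  obtain ⟨R, hR0, hR⟩ := hS.isBounded.exists_pos_norm_le
  have hsum : Summable fun k => ‖c k‖ * R ^ k := by
    refine (hf R).summable.norm.congr fun k => ?_
    rw [norm_mul, norm_pow, Complex.norm_real, Real.norm_of_nonneg hR0.le]
  have hle : ∀ d k, 0 ≤ 1 - ratio n d k ∧ 1 - ratio n d k ≤ 1 := fun d k =>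
    ⟨by linarith [ratio_le_one hn d k], by linarith [ratio_nonneg hn d k]⟩
  have hb : ∀ d k, ‖c k‖ * R ^ k * (1 - ratio n d k) ≤ ‖c k‖ * R ^ k := fun d k =>
    mul_le_of_le_one_right (by positivity) (hle d k).2
  have hb0 : ∀ d k, 0 ≤ ‖c k‖ * R ^ k * (1 - ratio n d k) := fun d k =>
    mul_nonneg (by positivity) (hle d k).1
  have hE : Tendsto (fun d : ℕ => ∑' k, ‖c k‖ * R ^ k * (1 - ratio n d k)) atTop (𝓝 0) := by
    have := tendsto_tsum_of_dominated_convergence (𝓕 := atTop)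
      (f := fun d k => ‖c k‖ * R ^ k * (1 - ratio n d k)) (g := fun _ => 0) hsum
      (fun k => by
        have := ((tendsto_ratio n k).const_sub 1).const_mul (‖c k‖ * R ^ k)
        simpa using this)
      (Eventually.of_forall fun d k => by
        rw [Real.norm_of_nonneg (hb0 d k)]
        exact hb d k)
    simpa using this
  rw [Metric.tendstoUniformlyOn_iff]
  intro ε hε
  filter_upwards [hE.eventually (gt_mem_nhds hε)] with d hd z hz
  refine lt_of_le_of_lt ?_ hd
  have h1 := (hf z).sub (hasSum_eval_jensen n c d z)
  rw [dist_eq_norm, ← h1.tsum_eq]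
  refine tsum_of_norm_bounded ((hsum.of_nonneg_of_le (hb0 d) (hb d)).hasSum) fun k => ?_
  have h2 : c k * z ^ k - c k * z ^ k * (ratio n d k : ℂ) =
      c k * z ^ k * ((1 - ratio n d k : ℝ) : ℂ) := by push_cast; ring
  rw [h2, norm_mul, norm_mul, norm_pow, Complex.norm_real, Real.norm_of_nonneg (hle d k).1]
  have := hR z hz
  have := (hle d k).1
  gcongr

/-! ### From LP I to positive roots -/

/-- Up to sign the coefficient is an elementary symmetric function. The bound depends on `s` only
through its sum. -/
theorem norm_coeff_prodPoly_le {s : Multiset ℝ} (hs : ∀ c ∈ s, 0 ≤ c) (k : ℕ) :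
    ‖(prodPoly s).coeff k‖ ≤ s.sum ^ k / k.factorial := by
  induction s using Multiset.induction_on generalizing k with
  | empty =>
    rw [prodPoly]
    cases k <;> simp [coeff_one]
  | cons c s ih =>
    have hc := hs c (Multiset.mem_cons_self c s)
    have hs' : ∀ c ∈ s, 0 ≤ c := fun c hc => hs c (Multiset.mem_cons_of_mem hc)
    have hsum := Multiset.sum_nonneg hs'
    cases k with
    | zero => rw [prodPoly_coeff_zero]; simp
    | succ k =>
      rw [prodPoly_cons, sub_mul, one_mul, mul_assoc, coeff_sub, coeff_C_mul, coeff_X_mul,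
        Multiset.sum_cons]
      refine (norm_sub_le _ _).trans ?_
      rw [norm_mul, Complex.norm_real, Real.norm_of_nonneg hc]
      have h1 := ih hs' (k + 1)
      have h2 := mul_le_mul_of_nonneg_left (ih hs' k) hc
      refine (add_le_add h1 h2).trans ?_
      -- The first two terms of the binomial expansion.
      have h3 : s.sum ^ (k + 1) + (k + 1) * c * s.sum ^ k ≤ (c + s.sum) ^ (k + 1) := by
        generalize s.sum = t at hsum
        clear ih h1 h2
        induction k with
        | zero => simp; linarith
        | succ k ih =>
          have h4 := mul_le_mul_of_nonneg_right ih (add_nonneg hc hsum)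
          rw [← pow_succ] at h4
          refine le_trans ?_ h4
          have : 0 ≤ ((k : ℝ) + 1) * c * c * t ^ k := by positivity
          push_cast
          ring_nf at this ⊢
          linarith
      rw [Nat.factorial_succ]
      push_cast
      have h5 : s.sum ^ (k + 1) / (((k : ℝ) + 1) * k.factorial) + c * (s.sum ^ k / k.factorial) =
          (s.sum ^ (k + 1) + (k + 1) * c * s.sum ^ k) / (((k : ℝ) + 1) * k.factorial) := by
        field_simp
      rw [h5]
      gcongr

theorem coeff_unique {a b : ℕ → ℂ} {f : ℂ → ℂ} (ha : ∀ z, HasSum (fun k => a k * z ^ k) (f z))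
    (hb : ∀ z, HasSum (fun k => b k * z ^ k) (f z)) : a = b := by
  have key : ∀ c : ℕ → ℂ, (∀ z, HasSum (fun k => c k * z ^ k) (f z)) →
      HasFPowerSeriesOnBall f (FormalMultilinearSeries.ofScalars ℂ c) 0 1 := by
    intro c hc
    refine ⟨?_, one_pos, ?_⟩
    · have : Summable fun k =>
          ‖FormalMultilinearSeries.ofScalars ℂ c k‖ * (1 : NNReal) ^ k := by
        refine (hc 1).summable.norm.congr fun k => ?_
        rw [FormalMultilinearSeries.ofScalars_norm]
        simp
      simpa using FormalMultilinearSeries.le_radius_of_summable _ this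
    · intro y _
      rw [zero_add]
      refine (hc y).congr_fun fun k => ?_
      rw [FormalMultilinearSeries.ofScalars_apply_eq]
      simp
  exact FormalMultilinearSeries.ofScalars_series_injective ℂ (E := ℂ)
    ((key a ha).hasFPowerSeriesAt.eq_formalMultilinearSeries (key b hb).hasFPowerSeriesAt)

theorem hasSum_coeff_mul_pow (p : ℂ[X]) (z : ℂ) :
    HasSum (fun k => p.coeff k * z ^ k) (p.eval z) := by
  rw [eval_eq_sum_range]
  refine hasSum_sum_of_ne_finset_zero fun k hk => ?_
  rw [coeff_eq_zero_of_natDegree_lt (by simpa using hk), zero_mul]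

/-- An ultrafilter gives limits of all coefficients at once. By domination with T^k/k! the limit
series sums to f, so these limits are the c_k. -/
theorem onlyPositiveRoots_jensen_of_tendsto {n : ℝ} (hn : -1 < n) {ι : Type*} {F : Filter ι}
    [F.NeBot] {s : ι → Multiset ℝ} (hs : ∀ i, ∀ c ∈ s i, 0 ≤ c) {T : ℝ}
    (hT : ∀ i, (s i).sum ≤ T) {c : ℕ → ℂ} {f : ℂ → ℂ}
    (hf : ∀ z, HasSum (fun k => c k * z ^ k) (f z))
    (hlim : ∀ z, Tendsto (fun i => (prodPoly (s i)).eval z) F (𝓝 (f z))) (d : ℕ) :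
    OnlyPositiveRoots (jensen n c d) := by
  let U := Ultrafilter.of F
  have hU : (U : Filter ι) ≤ F := Ultrafilter.of_le F
  have hb : ∀ i k, ‖(prodPoly (s i)).coeff k‖ ≤ T ^ k / k.factorial := fun i k =>
    (norm_coeff_prodPoly_le (hs i) k).trans (by
      have := Multiset.sum_nonneg (hs i)
      have := hT i
      gcongr)
  have ha : ∀ k, ∃ a : ℂ, Tendsto (fun i => (prodPoly (s i)).coeff k) U (𝓝 a) := by
    intro k
    obtain ⟨a, -, ha⟩ := (isCompact_closedBall (0 : ℂ) (T ^ k / k.factorial)).ultrafilter_le_nhds'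
      (U.map fun i => (prodPoly (s i)).coeff k)
      (by
        rw [Ultrafilter.mem_map]
        exact Eventually.of_forall fun i => by simpa using hb i k)
    exact ⟨a, ha⟩
  choose a ha using ha
  have hbz : ∀ i z k, ‖(prodPoly (s i)).coeff k * z ^ k‖ ≤ (T * ‖z‖) ^ k / k.factorial := by
    intro i z k
    rw [norm_mul, norm_pow, mul_pow, mul_div_right_comm]
    exact mul_le_mul_of_nonneg_right (hb i k) (by positivity)
  have hsum : ∀ z, HasSum (fun k => a k * z ^ k) (f z) := by
    intro z
    have hlim1 : ∀ k, Tendsto (fun i => (prodPoly (s i)).coeff k * z ^ k) U (𝓝 (a k * z ^ k)) :=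
      fun k => (ha k).mul_const _
    have h1 := tendsto_tsum_of_dominated_convergence (𝓕 := (U : Filter ι))
      (Real.summable_pow_div_factorial (T * ‖z‖)) hlim1
      (Eventually.of_forall fun i k => hbz i z k)
    have h2 : Summable fun k => a k * z ^ k :=
      Summable.of_norm_bounded (Real.summable_pow_div_factorial (T * ‖z‖)) fun k =>
        le_of_tendsto' (hlim1 k).norm fun i => hbz i z k
    simp only [(hasSum_coeff_mul_pow _ z).tsum_eq] at h1
    rw [tendsto_nhds_unique ((hlim z).mono_left hU) h1]
    exact h2.hasSum
  obtain rfl := coeff_unique hsum hf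
  refine onlyPositiveRoots_of_tendsto (F := (U : Filter ι))
    (P := fun i => jensen n (prodPoly (s i)).coeff d) (d := d) (fun i => ?_)
    (fun i => natDegree_jensen_le _ _ _)
    (fun i => onlyPositiveRoots_jensen_prodPoly hn (hs i) d) (natDegree_jensen_le _ _ _) fun k => ?_
  · rw [jensen_coeff, prodPoly_coeff_zero, weight_zero]
    simp
  · simp only [jensen_coeff]
    exact (ha k).mul_const _

theorem prodPoly_eval (s : Multiset ℝ) (z : ℂ) :
    (prodPoly s).eval z = (s.map fun c : ℝ => 1 - (c : ℂ) * z).prod := by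
  rw [prodPoly, eval_multiset_prod, Multiset.map_map]
  simp

theorem onlyPositiveRoots_of_inLPI {n : ℝ} (hn : -1 < n) {g : PowerSeries ℂ} (hg : InLPI g)
    (d : ℕ) : OnlyPositiveRoots (laguerreJensen n g d) := by
  obtain ⟨f, ⟨σ, N, α, -, -, hα, hf⟩, hgf⟩ := hg
  rw [laguerreJensen_eq_jensen]
  -- M copies of σ²/M contribute (1 - σ²z/M)^M, which tends to exp(-σ²z), and have sum at most σ².
  let s : ℕ × Finset {j : ℕ // (j : ℕ∞) < N} → Multiset ℝ := fun p =>
    Multiset.replicate p.1 (σ ^ 2 / p.1) + p.2.val.map fun j => 1 / α j ^ 2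
  refine onlyPositiveRoots_jensen_of_tendsto hn (F := atTop ×ˢ atTop) (s := s)
    (T := σ ^ 2 + ∑' j, 1 / α j ^ 2) ?_ ?_ hgf ?_ d
  · intro p c hc
    rcases Multiset.mem_add.1 hc with h | h
    · rw [Multiset.eq_of_mem_replicate h]
      positivity
    · obtain ⟨j, -, rfl⟩ := Multiset.mem_map.1 h
      positivity
  · intro p
    rw [Multiset.sum_add, Multiset.sum_replicate, nsmul_eq_mul]
    refine add_le_add ?_ (hα.sum_le_tsum p.2 fun j _ => by positivity)
    rcases Nat.eq_zero_or_pos p.1 with h | h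
    · rw [h]
      simp
      positivity
    · rw [mul_div_cancel₀]
      exact_mod_cast h.ne'
  · intro z
    rw [hf z]
    have h1 : Tendsto (fun M : ℕ => (1 + -(σ : ℂ) ^ 2 * z / M) ^ M) atTop
        (𝓝 (Complex.exp (-(σ : ℂ) ^ 2 * z))) := Complex.tendsto_one_add_div_pow_exp _
    have hsum : Summable fun j => -(z / (α j : ℂ) ^ 2) := by
      have := ((hα.map Complex.ofRealCLM Complex.continuous_ofReal).mul_left z).neg
      refine this.congr fun j => ?_
      simp [div_eq_mul_inv]
    have h2 : HasProd (fun j => 1 - z / (α j : ℂ) ^ 2) (∏' j, (1 - z / (α j : ℂ) ^ 2)) := by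
      have := (multipliable_one_add_of_summable hsum.norm).hasProd
      simpa only [← sub_eq_add_neg] using this
    have h2' : Tendsto (fun t : Finset {j : ℕ // (j : ℕ∞) < N} =>
        ∏ j ∈ t, (1 - z / (α j : ℂ) ^ 2)) atTop (𝓝 (∏' j, (1 - z / (α j : ℂ) ^ 2))) := by
      simpa [HasProd] using h2
    have h3 : Tendsto (fun p : ℕ × Finset {j : ℕ // (j : ℕ∞) < N} =>
        (1 + -(σ : ℂ) ^ 2 * z / p.1) ^ p.1 * ∏ j ∈ p.2, (1 - z / (α j : ℂ) ^ 2))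
        (atTop ×ˢ atTop) (𝓝 (Complex.exp (-(σ : ℂ) ^ 2 * z) * ∏' j, (1 - z / (α j : ℂ) ^ 2))) :=
      (h1.comp tendsto_fst).mul (h2'.comp tendsto_snd)
    refine h3.congr fun p => ?_
    rw [prodPoly_eval, Multiset.map_add, Multiset.prod_add, Multiset.map_replicate,
      Multiset.prod_replicate, Multiset.map_map, Finset.prod]
    congr 2
    · push_cast
      ring
    · refine Multiset.map_congr rfl fun j _ => ?_
      simp only [Function.comp_apply]
      push_cast
      ring

/-! ### From positive roots to LP I -/

theorem prodPoly_coeff_one (s : Multiset ℝ) : (prodPoly s).coeff 1 = -(s.sum : ℂ) := by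
  induction s using Multiset.induction_on with
  | empty => simp [prodPoly, coeff_one]
  | cons c s ih =>
    rw [prodPoly_cons, mul_coeff_one, ih, prodPoly_coeff_zero, Multiset.sum_cons]
    simp [coeff_one]

theorem prodPoly_comp (s : Multiset ℝ) (t : ℝ) :
    (prodPoly s).comp (C (t : ℂ) * X) = prodPoly (s.map fun c => c * t) := by
  rw [prodPoly, prodPoly, multiset_prod_comp, Multiset.map_map, Multiset.map_map]
  refine congrArg _ (Multiset.map_congr rfl fun c _ => ?_)
  simp
  ring

theorem exists_scaled_factorization {n : ℝ} (hn : -1 < n) {c : ℕ → ℂ} (hc0 : c 0 = 1) {d : ℕ}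
    (hd : 1 ≤ d) (h : OnlyPositiveRoots (jensen n c d)) :
    ∃ (m : ℕ) (β : ℕ → ℝ), Antitone β ∧ (∀ i, 0 ≤ β i) ∧ (∀ i, m ≤ i → β i = 0) ∧
      ∀ k, (prodPoly ((Multiset.range m).map β)).coeff k = c k * (ratio n d k : ℂ) := by
  obtain ⟨m, β, -, hanti, hnn, hz, hp⟩ := exists_antitone_factorization
    (by rw [jensen_coeff, weight_zero, hc0]; simp) h
  have hd1 : (1 : ℝ) ≤ d := by exact_mod_cast hd
  have hD : 0 < (d : ℝ) * (n + d) := mul_pos (by linarith) (by linarith)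
  set t := ((d : ℝ) * (n + d))⁻¹ with ht
  have ht0 : 0 < t := inv_pos.2 hD
  refine ⟨m, fun i => β i * t, fun i j hij => mul_le_mul_of_nonneg_right (hanti hij) ht0.le,
    fun i => mul_nonneg (hnn i) ht0.le, fun i hi => by simp [hz i hi], fun k => ?_⟩
  have h1 : (Multiset.range m).map (fun i => β i * t) =
      ((Multiset.range m).map β).map fun c => c * t := by
    rw [Multiset.map_map]
    rfl
  rw [h1, ← prodPoly_comp, ← hp, comp_C_mul_X_coeff, jensen_coeff, ratio, ht]
  push_cast
  rw [inv_pow]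
  ring

/-- Makes the sum of the scaled reciprocal roots equal to -c_1 for every d. -/
theorem ratio_one {n : ℝ} (hn : -1 < n) {d : ℕ} (hd : 1 ≤ d) : ratio n d 1 = 1 := by
  have hd1 : (1 : ℝ) ≤ d := by exact_mod_cast hd
  have hD : 0 < (d : ℝ) * (n + d) := mul_pos (by linarith) (by linarith)
  rw [ratio, weight_succ n (Nat.zero_le d), weight_zero, pow_one, div_eq_one_iff_eq hD.ne']
  simp
  ring

/-- The linear terms of 1 - w and e^w cancel. -/
theorem norm_one_sub_mul_exp_sub_one_le (w : ℂ) :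
    ‖(1 - w) * Complex.exp w - 1‖ ≤ 3 * ‖w‖ ^ 2 * Real.exp ‖w‖ := by
  have he : 1 ≤ Real.exp ‖w‖ := Real.one_le_exp (norm_nonneg w)
  rcases le_total ‖w‖ 1 with h | h
  · have h1 := Complex.norm_exp_sub_one_sub_id_le h
    have h2 : (1 - w) * Complex.exp w - 1 = (1 - w) * (Complex.exp w - 1 - w) - w ^ 2 := by ring
    have h3 : ‖1 - w‖ ≤ 2 := (norm_sub_le _ _).trans (by rw [norm_one]; linarith)
    calc ‖(1 - w) * Complex.exp w - 1‖ ≤ ‖1 - w‖ * ‖Complex.exp w - 1 - w‖ + ‖w‖ ^ 2 := by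
          rw [h2, ← norm_mul, ← norm_pow]
          exact norm_sub_le _ _
      _ ≤ 2 * ‖w‖ ^ 2 + ‖w‖ ^ 2 := by gcongr
      _ = 3 * ‖w‖ ^ 2 * 1 := by ring
      _ ≤ _ := by gcongr
  · have h1 : ‖Complex.exp w‖ ≤ Real.exp ‖w‖ := Complex.norm_exp_le_exp_norm w
    calc ‖(1 - w) * Complex.exp w - 1‖ ≤ ‖1 - w‖ * ‖Complex.exp w‖ + 1 := by
          rw [← norm_mul]
          exact (norm_sub_le _ _).trans (by rw [norm_one])
      _ ≤ (1 + ‖w‖) * Real.exp ‖w‖ + Real.exp ‖w‖ := by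
          gcongr
          exact (norm_sub_le _ _).trans (by rw [norm_one])
      _ = (2 + ‖w‖) * Real.exp ‖w‖ := by ring
      _ ≤ 3 * ‖w‖ ^ 2 * Real.exp ‖w‖ := by
          gcongr
          nlinarith

theorem le_div_succ_of_antitone_of_hasSum {β : ℕ → ℝ} (hanti : Antitone β) (hnn : ∀ i, 0 ≤ β i)
    {S : ℝ} (h : HasSum β S) (i : ℕ) : β i ≤ S / (i + 1) := by
  rw [le_div_iff₀ (by positivity)]
  calc β i * (i + 1) = ∑ _j ∈ Finset.range (i + 1), β i := by simp; ring
    _ ≤ ∑ j ∈ Finset.range (i + 1), β j := Finset.sum_le_sum fun j hj =>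
        hanti (Nat.lt_succ_iff.1 (Finset.mem_range.1 hj))
    _ ≤ S := sum_le_hasSum _ (fun j _ => hnn j) h

theorem mem_laguerrePolyaI_of_antitone {b : ℕ → ℝ} (hanti : Antitone b) (hnn : ∀ i, 0 ≤ b i)
    (hsum : Summable b) {τ : ℝ} (hτ : 0 ≤ τ) {f : ℂ → ℂ}
    (hf : ∀ z, f z = Complex.exp (-(τ : ℂ) * z) * ∏' i, (1 - b i * z)) :
    f ∈ LaguerrePolyaI := by
  -- The support of b is an initial segment: N is its first zero, or ⊤ if there is none.
  obtain ⟨N, hN⟩ : ∃ N : ℕ∞, ∀ j : ℕ, (j : ℕ∞) < N ↔ b j ≠ 0 := by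
    by_cases h : ∃ j, b j = 0
    · classical
      refine ⟨(Nat.find h : ℕ), fun j => ?_⟩
      rw [Nat.cast_lt, Nat.lt_find_iff]
      refine ⟨fun hj => hj j le_rfl, fun hj m hm hm0 => hj ?_⟩
      exact le_antisymm ((hanti hm).trans hm0.le) (hnn j)
    · push Not at h
      exact ⟨⊤, fun j => by simp [h j]⟩
  have hα : ∀ j : {j : ℕ // (j : ℕ∞) < N}, 1 / (Real.sqrt (b j))⁻¹ ^ 2 = b j := fun j => by
    rw [inv_pow, Real.sq_sqrt (hnn _), one_div, inv_inv]
  refine ⟨Real.sqrt τ, N, fun j => (Real.sqrt (b j))⁻¹, Real.sqrt_nonneg _, fun j => ?_, ?_,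
    fun z => ?_⟩
  · have := lt_of_le_of_ne (hnn j) ((hN j).1 j.2).symm
    positivity
  · simp_rw [hα]
    exact hsum.subtype {j : ℕ | (j : ℕ∞) < N}
  · rw [hf z, ← Complex.ofReal_pow, Real.sq_sqrt hτ]
    congr 1
    have h1 : ∀ j : {j : ℕ // (j : ℕ∞) < N},
        1 - z / (((Real.sqrt (b j))⁻¹ : ℝ) : ℂ) ^ 2 = 1 - b j * z := fun j => by
      rw [← Complex.ofReal_pow, div_eq_mul_one_div z, ← Complex.ofReal_one,
        ← Complex.ofReal_div, hα, mul_comm]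
    simp_rw [h1]
    symm
    refine tprod_subtype_eq_of_mulSupport_subset (f := fun i => 1 - (b i : ℂ) * z)
      (s := {j : ℕ | (j : ℕ∞) < N}) fun j hj => ?_
    refine (hN j).2 fun h0 => hj ?_
    simp [h0]

theorem inLPI_of_onlyPositiveRoots {n : ℝ} (hn : -1 < n) {g : PowerSeries ℂ}
    (hg : PowerSeries.coeff 0 g = 1)
    (h : ∀ d : ℕ, 1 ≤ d → OnlyPositiveRoots (laguerreJensen n g d)) : InLPI g := by
  set c : ℕ → ℂ := fun k => PowerSeries.coeff k g with hc
  -- Degree d + 1 keeps the scaling factor d(n+d) positive.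
  have h' : ∀ d : ℕ, OnlyPositiveRoots (jensen n c (d + 1)) := fun d => by
    rw [← laguerreJensen_eq_jensen]
    exact h _ (Nat.succ_pos d)
  choose m β hanti hnn hz hcoef using
    fun d => exists_scaled_factorization hn hg (Nat.succ_pos d) (h' d)
  set S : ℝ := -(c 1).re with hS
  have hsumβ : ∀ d, ((Multiset.range (m d)).map (β d)).sum = S := by
    intro d
    have := hcoef d 1
    rw [ratio_one hn (Nat.succ_pos d), prodPoly_coeff_one, Complex.ofReal_one, mul_one] at this
    rw [hS, ← this]
    simp
  have hasSumβ : ∀ d, HasSum (β d) S := by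
    intro d
    rw [← hsumβ d]
    exact hasSum_sum_of_ne_finset_zero (s := Finset.range (m d)) fun i hi =>
      hz d i (by simpa using hi)
  have hS0 : 0 ≤ S := (hasSumβ 0).nonneg (hnn 0)
  have hpos : ∀ d, ∀ x ∈ (Multiset.range (m d)).map (β d), 0 ≤ x := by
    intro d x hx
    obtain ⟨i, -, rfl⟩ := Multiset.mem_map.1 hx
    exact hnn d i
  have hratio : ∀ k, Tendsto (fun d => ratio n (d + 1) k) atTop (𝓝 1) := fun k =>
    (tendsto_ratio n k).comp (tendsto_add_atTop_nat 1)
  have hcb : ∀ k, ‖c k‖ ≤ S ^ k / k.factorial := by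
    intro k
    have h1 : Tendsto (fun d => c k * (ratio n (d + 1) k : ℂ)) atTop (𝓝 (c k * (1 : ℝ))) :=
      ((Complex.continuous_ofReal.tendsto 1).comp (hratio k)).const_mul _
    rw [Complex.ofReal_one, mul_one] at h1
    refine le_of_tendsto' h1.norm fun d => ?_
    rw [← hcoef, ← hsumβ d]
    exact norm_coeff_prodPoly_le (hpos d) k
  have hcs : ∀ z, Summable fun k => c k * z ^ k := fun z =>
    Summable.of_norm_bounded (Real.summable_pow_div_factorial (S * ‖z‖)) fun k => by
      rw [norm_mul, norm_pow, mul_pow, mul_div_right_comm]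
      exact mul_le_mul_of_nonneg_right (hcb k) (by positivity)
  set f : ℂ → ℂ := fun z => ∑' k, c k * z ^ k with hfdef
  have hf : ∀ z, HasSum (fun k => c k * z ^ k) (f z) := fun z => (hcs z).hasSum
  have hlim : ∀ z : ℂ, Tendsto (fun d => ∏ i ∈ Finset.range (m d), (1 - (β d i : ℂ) * z)) atTop
      (𝓝 (f z)) := by
    intro z
    have h1 := ((tendstoUniformlyOn_jensen hn hf (isCompact_singleton (x := z))).tendsto_at
      rfl).comp (tendsto_add_atTop_nat 1)
    refine h1.congr fun d => ?_
    have h2 := hasSum_coeff_mul_pow (prodPoly ((Multiset.range (m d)).map (β d))) z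
    simp only [hcoef, mul_right_comm] at h2
    rw [Function.comp_apply, (hasSum_eval_jensen n c (d + 1) z).unique h2, prodPoly_eval,
      Multiset.map_map]
    rfl
  -- A single ultrafilter makes `β d i` converge for all i simultaneously, without a diagonal
  -- argument.
  let U := Ultrafilter.of (atTop : Filter ℕ)
  have hU : (U : Filter ℕ) ≤ atTop := Ultrafilter.of_le _
  have hβS : ∀ d i, β d i ≤ S / (i + 1) := fun d i =>
    le_div_succ_of_antitone_of_hasSum (hanti d) (hnn d) (hasSumβ d) i
  have hb : ∀ i, ∃ b : ℝ, Tendsto (fun d => β d i) U (𝓝 b) := by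
    intro i
    obtain ⟨b, -, hb⟩ := (isCompact_Icc (a := (0 : ℝ)) (b := S / (i + 1))).ultrafilter_le_nhds'
      (U.map fun d => β d i)
      (by
        rw [Ultrafilter.mem_map]
        exact Eventually.of_forall fun d => ⟨hnn d i, hβS d i⟩)
    exact ⟨b, hb⟩
  choose b hb using hb
  have hbanti : Antitone b := fun i j hij => le_of_tendsto_of_tendsto' (hb j) (hb i) fun d =>
    hanti d hij
  have hbnn : ∀ i, 0 ≤ b i := fun i => ge_of_tendsto' (hb i) fun d => hnn d i
  have hbfin : ∀ u : Finset ℕ, ∑ i ∈ u, b i ≤ S := fun u =>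
    le_of_tendsto' (tendsto_finsetSum u fun i _ => hb i) fun d =>
      sum_le_hasSum u (fun i _ => hnn d i) (hasSumβ d)
  have hbsum : Summable b := summable_of_sum_le hbnn hbfin
  have hbS : ∑' i, b i ≤ S := hbsum.tsum_le_of_sum_le hbfin
  -- Here τ = S - ∑ b_i, nonnegative by `hbS`.
  refine ⟨f, mem_laguerrePolyaI_of_antitone hbanti hbnn hbsum (sub_nonneg.2 hbS) fun z => ?_, hf⟩
  -- S/(i+1) is not summable, so the bare factors are not dominated; the exponentials improve the
  -- bound to order 1/(i+1)².
  have hprod : f z * Complex.exp (S * z) = ∏' i, ((1 - b i * z) * Complex.exp (b i * z)) := by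
    have hbound : ∀ d i, ‖(1 - β d i * z) * Complex.exp (β d i * z) - 1‖ ≤
        3 * (S * ‖z‖) ^ 2 * Real.exp (S * ‖z‖) * (1 / ((i : ℝ) + 1) ^ 2) := by
      intro d i
      have h1 : ‖(β d i : ℂ) * z‖ ≤ S * ‖z‖ * (1 / ((i : ℝ) + 1)) := by
        rw [norm_mul, Complex.norm_real, Real.norm_of_nonneg (hnn d i)]
        calc β d i * ‖z‖ ≤ S / (i + 1) * ‖z‖ :=
              mul_le_mul_of_nonneg_right (hβS d i) (norm_nonneg z)
          _ = _ := by ring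
      have h2 : ‖(β d i : ℂ) * z‖ ≤ S * ‖z‖ := h1.trans
        (mul_le_of_le_one_right (by positivity) (by
          rw [div_le_one (by positivity)]
          linarith [(Nat.cast_nonneg i : (0 : ℝ) ≤ i)]))
      calc _ ≤ 3 * ‖(β d i : ℂ) * z‖ ^ 2 * Real.exp ‖(β d i : ℂ) * z‖ :=
            norm_one_sub_mul_exp_sub_one_le _
        _ ≤ 3 * (S * ‖z‖ * (1 / ((i : ℝ) + 1))) ^ 2 * Real.exp (S * ‖z‖) := by gcongr
        _ = _ := by rw [mul_pow, one_div_pow]; ring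
    have hbs : Summable fun i : ℕ =>
        3 * (S * ‖z‖) ^ 2 * Real.exp (S * ‖z‖) * (1 / ((i : ℝ) + 1) ^ 2) := by
      refine Summable.mul_left _ ?_
      have := (summable_nat_add_iff 1).2 (Real.summable_one_div_nat_pow.2 one_lt_two)
      simpa using this
    have hterm : ∀ i, Tendsto (fun d => (1 - β d i * z) * Complex.exp (β d i * z) - 1) U
        (𝓝 ((1 - b i * z) * Complex.exp (b i * z) - 1)) := by
      intro i
      have h1 : Tendsto (fun d => (β d i : ℂ) * z) U (𝓝 (b i * z)) :=
        ((Complex.continuous_ofReal.tendsto _).comp (hb i)).mul_const _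
      exact ((h1.const_sub 1).mul ((Complex.continuous_exp.tendsto _).comp h1)).sub_const 1
    have h1 := tendsto_tprod_one_add_of_dominated_convergence hbs hterm
      (Eventually.of_forall fun d i => hbound d i)
    simp only [add_sub_cancel] at h1
    refine tendsto_nhds_unique ?_ h1
    refine (((hlim z).mono_left hU).mul_const (Complex.exp (S * z))).congr fun d => ?_
    -- Padding zeros give factors 1, and the exponentials multiply to exp(Sz).
    rw [tprod_eq_prod (s := Finset.range (m d)) fun i hi => by
      rw [hz d i (by simpa using hi)]; simp, Finset.prod_mul_distrib, ← Complex.exp_sum,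
      ← Finset.sum_mul, ← Complex.ofReal_sum]
    rw [← hsumβ d]
    rfl
  have hexp : HasProd (fun i => Complex.exp (b i * z)) (Complex.exp ((∑' i, b i : ℝ) * z)) :=
    (((Complex.hasSum_ofReal.2 hbsum.hasSum)).mul_right z).cexp
  have hmul : Multipliable fun i => 1 - (b i : ℂ) * z := by
    have h1 : Summable fun i => -((b i : ℂ) * z) :=
      ((Complex.hasSum_ofReal.2 hbsum.hasSum).mul_right z).summable.neg
    simpa only [← sub_eq_add_neg] using multipliable_one_add_of_summable h1.norm
  rw [(hmul.hasProd.mul hexp).tprod_eq] at hprod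
  refine mul_right_cancel₀ (Complex.exp_ne_zero (S * z)) (hprod.trans ?_)
  rw [mul_right_comm, ← Complex.exp_add, mul_comm]
  congr 2
  push_cast
  ring

end LaguerreJensen

theorem mainTheorem11 (n : ℝ) (hn : -1 < n) (g : PowerSeries ℂ)
    (hg : PowerSeries.coeff 0 g = 1) :
    (InLPI g ↔ ∀ d : ℕ, 1 ≤ d → OnlyPositiveRoots (laguerreJensen n g d)) ∧
    ∀ f : ℂ → ℂ, HasEntireSum g f → ∀ S : Set ℂ, IsCompact S →
      TendstoUniformlyOn
        (fun (d : ℕ) (z : ℂ) =>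
          (laguerreJensen n g d).eval (z / ((d : ℂ) * ((n : ℂ) + (d : ℂ)))))
        f atTop S := by
  refine ⟨⟨fun h d _ => LaguerreJensen.onlyPositiveRoots_of_inLPI hn h d,
    LaguerreJensen.inLPI_of_onlyPositiveRoots hn hg⟩, fun f hf S hS => ?_⟩
  simp only [LaguerreJensen.laguerreJensen_eq_jensen]
  exact LaguerreJensen.tendstoUniformlyOn_jensen hn hf hS
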